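/- Let $G=(V,E)$ be a finite simple graph. Let $0\notin V$, let $\widehat{\mathbb S}^V$ be the space of real symmetric matrices indexed by $\{0\}\cup V$ with the trace inner product $\langle\cdot,\cdot\rangle$, let $e_i$ be the standard basis vectors of $\mathbb R^{\{0\}\cup V}$, and put $\operatorname{Sym}(M)=\tfrac12(M+M^{\mathsf T})$. Consider a system $\langle \hat A_i,\hat X\rangle\le b_i$ $(i\in[m])$, $\hat X\succeq 0$, with $\hat A_i\in\widehat{\mathbb S}^V$ and $b\in\mathbb R^m$ (an equation stands for two opposite inequalities, and $\ge$ for the negated inequality), and a linear map $\mathcal L:\mathbb R^k\to\widehat{\mathbb S}^V$. For $c\in\mathbb Z^k$, the dual of $\sup\{\langle\mathcal L(c),\hat X\rangle : \langle\hat A_i,\hat X\rangle\le b_i\ \forall i,\ \hat X\succeq0\}$ is $$\inf\Bigl\{b^{\mathsf T}y : y\in\mathbb R^m_+,\ \hat S=\sum_i y_i\hat A_i-\mathcal L(c)\succeq0\Bigr\}.$$ A dual solution $(y,\hat S)$ is *integral* if $y\in\mathbb Z^m$ and $$\hat S=\sum_{K\subseteq V}m_K\begin{bmatrix}-1\\ \mathbb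 1_K\end{bmatrix}\begin{bmatrix}-1\\ \mathbb 1_K\end{bmatrix}^{\mathsf T}$$ for some nonnegative integers $m_K$, where $\mathbb 1_K\in\{0,1\}^V$ is the incidence vector of $K$. The system is *totally dual integral (TDI) through $\mathcal L$* if, for every $c\in\mathbb Z^k$, the dual has an integral optimal solution whenever it has an optimal solution. Let $(\mathrm B)$ denote the constraints $\langle e_0e_0^{\mathsf T},\hat X\rangle=1$, and $\langle 2\operatorname{Sym}(e_j(e_j-e_0)^{\mathsf T}),\hat X\rangle=0$ and $\langle e_je_j^{\mathsf T},\hat X\rangle\ge0$ for all $j\in V$. The defining systems of the SDP formulations of the Lovász function $\theta$ of $G$ and of its variants $\theta'$ and $\theta^+$ are: - $(\theta)$: $(\mathrm B)$, $\langle2\operatorname{Sym}(e_ie_j^{\mathsf T}),\hat X\rangle=0$ for all $ij\in E$, and $\hat X\succeq0$; - $(\theta')$: the constraints of $(\theta)$ and $\langle2\operatorname{Sym}(e_ie_j^{\mathsf T}),\hat X\rangle\ge0$ for all pairs $ij$ of distinct non-adjacent vertices; - $(\theta^+)$: $(\mathrm B)$, $\langle2\operatorname{Sym}(e_ie_j^{\mathsf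 T}),\hat X\rangle\le0$ for all $ij\in E$, and $\hat X\succeq0$. Then the system $(\theta)$ is TDI through the lifting $w\in\mathbb R^V\mapsto\operatorname{Diag}(0\oplus w)$ if and only if $G$ is perfect, i.e. $\omega(G[U])=\chi(G[U])$ for every $U\subseteq V$. Likewise, the system $(\theta')$ is TDI through this lifting if and only if $G$ is perfect, and the system $(\theta^+)$ is TDI through this lifting if and only if $G$ is perfect. -/

import Mathlib

namespace ThetaTDI

/-- The space `Ŝ^V` of symmetric real matrices on the lifted index set `{0} ∪ V`.
The extra index `0` is `none : Option V`. -/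
def SymHat (V : Type*) : Submodule ℝ (Matrix (Option V) (Option V) ℝ) where
  carrier := {X | X.transpose = X}
  add_mem' := by
    intro X Y hX hY
    change (X + Y).transpose = X + Y
    rw [Matrix.transpose_add, hX, hY]
  zero_mem' := Matrix.transpose_zero
  smul_mem' := by
    intro c X hX
    change (c • X).transpose = c • X
    rw [Matrix.transpose_smul, hX]

/-- A linear system `⟨A i, X⟩ ≤ b i` (`i : ι`) on a variable `X ∈ Ŝ^V`; the semidefinite
system that it defines has the further constraint `X ⪰ 0`. -/
structure SDPSystem (V ι : Type*) where
  A : ι → SymHat V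
  b : ι → ℝ

namespace SDPSystem

variable {V ι κ : Type*}

/-- The constraints `⟨A i, X⟩ ≤ b i`. -/
def le (A : ι → SymHat V) (b : ι → ℝ) : SDPSystem V ι := ⟨A, b⟩

/-- The constraints `⟨A i, X⟩ ≥ b i`. -/
def ge (A : ι → SymHat V) (b : ι → ℝ) : SDPSystem V ι := ⟨fun i => -A i, fun i => -b i⟩

/-- All constraints of two systems together. -/
def append (S : SDPSystem V ι) (T : SDPSystem V κ) : SDPSystem V (ι ⊕ κ) :=
  ⟨Sum.elim S.A T.A, Sum.elim S.b T.b⟩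

/-- The constraints `⟨A i, X⟩ = b i`, as pairs of opposite inequalities. -/
def eq (A : ι → SymHat V) (b : ι → ℝ) : SDPSystem V (ι ⊕ ι) := (le A b).append (ge A b)

/-- Feasibility of `X` in the primal semidefinite program
`sup {⟨C, X⟩ : ⟨A i, X⟩ ≤ b i for all i, X ⪰ 0}`. -/
def PrimalFeasible [Fintype V] (S : SDPSystem V ι) (X : Matrix (Option V) (Option V) ℝ) : Prop :=
  X.PosSemidef ∧ ∀ i, ((S.A i).1 * X.transpose).trace ≤ S.b i

/-- The dual slack `∑ i, y i • A i - C`. -/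
def slack [Fintype ι] (S : SDPSystem V ι) (C : SymHat V) (y : ι → ℝ) : SymHat V :=
  ∑ i, y i • S.A i - C

/-- Feasibility in the dual program `inf {bᵀ y : y ≥ 0, ∑ i, y i • A i - C ⪰ 0}`. -/
def DualFeasible [Fintype ι] (S : SDPSystem V ι) (C : SymHat V) (y : ι → ℝ) : Prop :=
  (∀ i, 0 ≤ y i) ∧ (S.slack C y).1.PosSemidef

/-- Optimality in the dual program. -/
def DualOptimal [Fintype ι] (S : SDPSystem V ι) (C : SymHat V) (y : ι → ℝ) : Prop :=
  S.DualFeasible C y ∧ ∀ y', S.DualFeasible C y' → ∑ i, S.b i * y i ≤ ∑ i, S.b i * y' i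

end SDPSystem

/-- The vector `(-1) ⊕ 𝟙_K` on `{0} ∪ V`. -/
def negIncid {V : Type*} [DecidableEq V] (K : Finset V) : Option V → ℝ
  | none => -1
  | some i => if i ∈ K then 1 else 0

/-- Integrality of a dual slack: `S = ∑_{K ⊆ V} m_K ((-1) ⊕ 𝟙_K) ((-1) ⊕ 𝟙_K)ᵀ` for some
nonnegative integers `m_K`. -/
def IntegralSlack {V : Type*} [Fintype V] [DecidableEq V] (S : SymHat V) : Prop :=
  ∃ m : Finset V → ℕ, S.1 = ∑ K : Finset V, (m K : ℝ) • Matrix.vecMulVec (negIncid K) (negIncid K)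

/-- A dual solution is integral if both the vector `y` and its slack are integral. -/
def IntegralDual {V ι : Type*} [Fintype V] [DecidableEq V] [Fintype ι]
    (S : SDPSystem V ι) (C : SymHat V) (y : ι → ℝ) : Prop :=
  (∀ i, ∃ n : ℤ, y i = n) ∧ IntegralSlack (S.slack C y)

/-- Total dual integrality through the lifting map `L`. -/
def IsTDIThrough {V ι κ : Type*} [Fintype V] [DecidableEq V] [Fintype ι]
    (S : SDPSystem V ι) (L : (κ → ℝ) →ₗ[ℝ] SymHat V) : Prop :=
  ∀ c : κ → ℤ, (∃ y, S.DualOptimal (L fun k => (c k : ℝ)) y) →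
    ∃ y, S.DualOptimal (L fun k => (c k : ℝ)) y ∧ IntegralDual S (L fun k => (c k : ℝ)) y

section Matrices

variable {V : Type*} [DecidableEq V]

/-- The standard basis vector `e_i` of `ℝ^({0} ∪ V)`. -/
def e (i : Option V) : Option V → ℝ := Pi.single i 1

/-- `2 Sym(x yᵀ) = x yᵀ + y xᵀ`. -/
def twoSym (x y : Option V → ℝ) : SymHat V :=
  ⟨Matrix.vecMulVec x y + Matrix.vecMulVec y x, by
    change Matrix.transpose _ = _
    rw [Matrix.transpose_add, Matrix.transpose_vecMulVec, Matrix.transpose_vecMulVec, add_comm]⟩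

/-- `x xᵀ`. -/
def outer (x : Option V → ℝ) : SymHat V :=
  ⟨Matrix.vecMulVec x x, Matrix.transpose_vecMulVec x x⟩

/-- `2 Sym(e_i e_jᵀ)` for an unordered pair `ij` of elements of `V`. -/
def pairMat : Sym2 V → SymHat V :=
  Sym2.lift ⟨fun i j => twoSym (e (some i)) (e (some j)), fun _ _ => Subtype.ext (add_comm _ _)⟩

/-- The lifting map `w ↦ Diag(0 ⊕ w)`. -/
def diagLift : (V → ℝ) →ₗ[ℝ] SymHat V where
  toFun w := ⟨Matrix.diagonal fun i => Option.elim i 0 w, Matrix.diagonal_transpose _⟩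
  map_add' w w' := by
    ext i j
    rcases i with _ | i <;> rcases j with _ | j <;>
      simp [Matrix.diagonal_apply]
    split_ifs <;> simp
  map_smul' c w := by
    ext i j
    rcases i with _ | i <;> rcases j with _ | j <;>
      simp [Matrix.diagonal_apply]

/-- The constraints `⟨e_0 e_0ᵀ, X⟩ = 1`, and `⟨2 Sym(e_j (e_j - e_0)ᵀ), X⟩ = 0` and
`⟨e_j e_jᵀ, X⟩ ≥ 0` for `j ∈ V`. -/
def baseSystem (V : Type*) [DecidableEq V] : SDPSystem V (((Unit ⊕ Unit) ⊕ (V ⊕ V)) ⊕ V) :=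
  ((SDPSystem.eq (fun _ : Unit => outer (e none)) (fun _ => 1)).append
    (SDPSystem.eq (fun j : V => twoSym (e (some j)) (e (some j) - e none)) (fun _ => 0))).append
    (SDPSystem.ge (fun j : V => outer (e (some j))) (fun _ => 0))

/-- The defining system of the formulation of `θ(G; w)`: additionally
`⟨2 Sym(e_i e_jᵀ), X⟩ = 0` for the edges `ij`. -/
def thetaSystem (G : SimpleGraph V) :
    SDPSystem V ((((Unit ⊕ Unit) ⊕ (V ⊕ V)) ⊕ V) ⊕ (G.edgeSet ⊕ G.edgeSet)) :=
  (baseSystem V).append (SDPSystem.eq (fun ij : G.edgeSet => pairMat ij.1) (fun _ => 0))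

/-- The defining system of the formulation of `θ'(G; w)`: that of `θ` with additionally
`⟨2 Sym(e_i e_jᵀ), X⟩ ≥ 0` for the pairs `ij` of distinct non-adjacent vertices. -/
def thetaPrimeSystem (G : SimpleGraph V) :
    SDPSystem V (((((Unit ⊕ Unit) ⊕ (V ⊕ V)) ⊕ V) ⊕ (G.edgeSet ⊕ G.edgeSet)) ⊕ Gᶜ.edgeSet) :=
  (thetaSystem G).append (SDPSystem.ge (fun ij : Gᶜ.edgeSet => pairMat ij.1) (fun _ => 0))

/-- The defining system of the formulation of `θ⁺(G; w)`: `⟨2 Sym(e_i e_jᵀ), X⟩ ≤ 0` for the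
edges `ij`. -/
def thetaPlusSystem (G : SimpleGraph V) :
    SDPSystem V ((((Unit ⊕ Unit) ⊕ (V ⊕ V)) ⊕ V) ⊕ G.edgeSet) :=
  (baseSystem V).append (SDPSystem.le (fun ij : G.edgeSet => pairMat ij.1) (fun _ => 0))

end Matrices

/-- `G` is perfect: `ω(G[U]) = χ(G[U])` for every set `U` of vertices. -/
def IsPerfect {V : Type*} (G : SimpleGraph V) : Prop :=
  ∀ U : Set V, ((G.induce U).cliqueNum : ℕ∞) = (G.induce U).chromaticNumber

end ThetaTDI

/-!
For all three systems, the dual solutions for the objective `Diag(0 ⊕ c)` correspond to the slacks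
`S ⪰ 0` with `c j ≤ -2 S 0j - S jj`, with sign restrictions on the entries at pairs of vertices, and
the value of a solution is `S 00`. The integral slacks are exactly the covers of the weights `c`
by cliques of `G`, and their values are the sizes of these covers.

If `G` is perfect, then Lovász's replication argument and the perfect graph theorem give, for all
weights, a clique cover whose size is the weight of a stable set; this cover is an integral
dual solution, and by weak duality it is optimal.

Conversely, the minimum of `S 00` is attained and homogeneous in the weights. Under total dual
integrality it is the clique cover number, which is therefore a sublinear functional on `ℕ^V`. By a
discrete Hahn–Banach theorem, at every weight vector `w` it agrees with a linear functional with
natural number coefficients that lies below it everywhere. Such a functional takes values at most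
`1` on cliques, so it is the incidence vector of a stable set, whose weight is thus the clique cover
number of `w`. Hence `Gᶜ` is perfect, and so is `G`.
-/

namespace ThetaTDI

open Finset

section Covers

variable {V : Type*} [DecidableEq V]

/-- The incidence vector of `K`, with natural number entries. -/
def incid (K : Finset V) : V → ℕ := fun v => if v ∈ K then 1 else 0

theorem incid_of_mem {K : Finset V} {v : V} (hv : v ∈ K) : incid K v = 1 := if_pos hv

theorem incid_of_notMem {K : Finset V} {v : V} (hv : v ∉ K) : incid K v = 0 := if_neg hv

theorem sum_incid (T K : Finset V) : ∑ v ∈ T, incid K v = #(T ∩ K) := by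
  simp [incid]

theorem incid_eq_sum (K : Finset V) : incid K = ∑ v ∈ K, incid {v} := by
  ext u
  simp [incid]

theorem sum_sub_incid_lt {w : V → ℕ} {T K : Finset V} {v : V} (hvT : v ∈ T) (hvK : v ∈ K)
    (hv : w v ≠ 0) : ∑ u ∈ T, (w - incid K) u < ∑ u ∈ T, w u := by
  refine sum_lt_sum (fun u _ => Nat.sub_le _ _) ⟨v, hvT, ?_⟩
  rw [Pi.sub_apply, incid_of_mem hvK]
  omega

theorem card_inter_le_one {H : SimpleGraph V} {K S : Finset V} (hK : H.IsClique K)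
    (hS : Hᶜ.IsClique S) : #(K ∩ S) ≤ 1 := by
  rw [card_le_one]
  intro a ha b hb
  rw [mem_inter] at ha hb
  by_contra hab
  exact (hS ha.2 hb.2 hab).2 (hK ha.1 hb.1 hab)

variable [Fintype V]

theorem sum_mul_incid (w : V → ℕ) (K : Finset V) : ∑ v, w v * incid K v = ∑ v ∈ K, w v := by
  simp [incid]

theorem sum_smul_incid_singleton (w : V → ℕ) : ∑ v, w v • incid {v} = w := by
  ext u
  simp [incid]

/-- The number of times that each vertex is covered by the family of sets in which every `K`
occurs `m K` times. -/
def coverage (m : Finset V → ℕ) : V → ℕ := ∑ K, m K • incid K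

theorem coverage_apply (m : Finset V → ℕ) (v : V) : coverage m v = ∑ K with v ∈ K, m K := by
  simp [coverage, incid, sum_filter]

theorem coverage_add (m m' : Finset V → ℕ) : coverage (m + m') = coverage m + coverage m' := by
  simp [coverage, add_smul, sum_add_distrib]

theorem coverage_single (K : Finset V) : coverage (Pi.single K 1) = incid K := by
  simp [coverage, Pi.single_apply, ite_smul]

theorem sum_mul_coverage (w : V → ℕ) (m : Finset V → ℕ) :
    ∑ v, w v * coverage m v = ∑ K, m K * ∑ v ∈ K, w v := by
  simp_rw [coverage, Finset.sum_apply, Pi.smul_apply, smul_eq_mul, mul_sum, mul_left_comm (w _)]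
  rw [sum_comm]
  simp_rw [← mul_sum, sum_mul_incid]

/-- The family of sets in which every `K` occurs `m K` times consists of cliques of `H` and
covers every vertex `v` at least `w v` times. -/
structure IsCliqueCover (H : SimpleGraph V) (w : V → ℕ) (m : Finset V → ℕ) : Prop where
  isClique : ∀ K, m K ≠ 0 → H.IsClique K
  le_coverage : w ≤ coverage m

theorem IsCliqueCover.exists_mem {H : SimpleGraph V} {w : V → ℕ} {m : Finset V → ℕ}
    (hm : IsCliqueCover H w m) {v : V} (hv : w v ≠ 0) : ∃ K, v ∈ K ∧ m K ≠ 0 := by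
  have hcov : ∑ K with v ∈ K, m K ≠ 0 := by
    rw [← coverage_apply]
    exact ((Nat.pos_of_ne_zero hv).trans_le (hm.le_coverage v)).ne'
  simpa using exists_ne_zero_of_sum_ne_zero hcov

/-- The weights `w` have a cover by at most `n` cliques of `H`, counted with multiplicities. -/
def HasCliqueCover (H : SimpleGraph V) (w : V → ℕ) (n : ℕ) : Prop :=
  ∃ m, IsCliqueCover H w m ∧ ∑ K, m K ≤ n

namespace HasCliqueCover

variable {H : SimpleGraph V} {w w' : V → ℕ} {n n' : ℕ}

theorem mono (h : HasCliqueCover H w n) (hw : w' ≤ w) (hn : n ≤ n') : HasCliqueCover H w' n' :=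
  let ⟨m, hm, hmn⟩ := h
  ⟨m, ⟨hm.isClique, hw.trans hm.le_coverage⟩, hmn.trans hn⟩

theorem zero : HasCliqueCover H 0 0 :=
  ⟨0, ⟨fun _ h => absurd rfl h, fun _ => Nat.zero_le _⟩, by simp⟩

theorem of_isClique {K : Finset V} (hK : H.IsClique K) : HasCliqueCover H (incid K) 1 := by
  refine ⟨Pi.single K 1, ⟨fun K' hK' => ?_, (coverage_single K).ge⟩, by simp⟩
  rw [Pi.single_apply, ne_eq, ite_eq_right_iff, Classical.not_imp] at hK'
  rwa [hK'.1]

theorem add (h : HasCliqueCover H w n) (h' : HasCliqueCover H w' n') :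
    HasCliqueCover H (w + w') (n + n') := by
  obtain ⟨m, hm, hmn⟩ := h
  obtain ⟨m', hm', hmn'⟩ := h'
  refine ⟨m + m', ⟨fun K hK => ?_, ?_⟩, ?_⟩
  · by_cases hmK : m K = 0
    · exact hm'.isClique K (by simpa [hmK] using hK)
    · exact hm.isClique K hmK
  · rw [coverage_add]
    exact add_le_add hm.le_coverage hm'.le_coverage
  · simpa only [Pi.add_apply, sum_add_distrib] using add_le_add hmn hmn'

theorem sum {ι : Type*} {s : Finset ι} {w : ι → V → ℕ} {n : ι → ℕ}
    (h : ∀ i ∈ s, HasCliqueCover H (w i) (n i)) :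
    HasCliqueCover H (∑ i ∈ s, w i) (∑ i ∈ s, n i) := by
  classical
  induction s using Finset.induction_on with
  | empty => exact zero
  | insert i s hi ih =>
    rw [sum_insert hi, sum_insert hi]
    exact (h i (mem_insert_self i s)).add (ih fun j hj => h j (mem_insert_of_mem hj))

theorem nsmul (h : HasCliqueCover H w n) (k : ℕ) : HasCliqueCover H (k • w) (k * n) := by
  simpa using sum (s := range k) fun _ _ => h

theorem of_sub_incid {K : Finset V} (h : HasCliqueCover H (w - incid K) n)
    (hK : H.IsClique K) : HasCliqueCover H w (n + 1) :=
  (h.add (of_isClique hK)).mono le_tsub_add le_rfl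

theorem exists_sub_incid (h : HasCliqueCover H w n) {v : V} (hv : w v ≠ 0) :
    ∃ (K : Finset V) (k : ℕ), H.IsClique K ∧ v ∈ K ∧ n = k + 1 ∧
      HasCliqueCover H (w - incid K) k := by
  obtain ⟨m, hm, hmn⟩ := h
  obtain ⟨K, hvK, hmK⟩ := hm.exists_mem hv
  obtain ⟨m', rfl⟩ : ∃ m', m = m' + Pi.single K 1 :=
    ⟨m - Pi.single K 1, (tsub_add_cancel_of_le <|
      update_le_iff.2 ⟨Nat.one_le_iff_ne_zero.2 hmK, fun _ _ => Nat.zero_le _⟩).symm⟩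
  simp only [Pi.add_apply, sum_add_distrib, sum_pi_single', mem_univ, if_true] at hmn
  refine ⟨K, n - 1, hm.isClique K hmK, hvK, by omega, m', ⟨fun K' hK' => ?_, ?_⟩, by omega⟩
  · exact hm.isClique K' (by simp [hK'])
  · rw [tsub_le_iff_right, ← coverage_single, ← coverage_add]
    exact hm.le_coverage

theorem sum_mul_le (h : HasCliqueCover H w n) {u : V → ℕ} {k : ℕ}
    (hu : ∀ K : Finset V, H.IsClique K → ∑ v ∈ K, u v ≤ k) : ∑ v, u v * w v ≤ n * k := by
  obtain ⟨m, hm, hmn⟩ := h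
  calc ∑ v, u v * w v ≤ ∑ v, u v * coverage m v :=
        sum_le_sum fun v _ => Nat.mul_le_mul_left _ (hm.le_coverage v)
    _ = ∑ K, m K * ∑ v ∈ K, u v := sum_mul_coverage u m
    _ ≤ ∑ K, m K * k := by
        refine sum_le_sum fun K _ => ?_
        by_cases hmK : m K = 0
        · simp [hmK]
        · exact Nat.mul_le_mul_left _ (hu K (hm.isClique K hmK))
    _ = (∑ K, m K) * k := (sum_mul _ _ _).symm
    _ ≤ n * k := Nat.mul_le_mul_right _ hmn

theorem sum_le_of_isClique_compl (h : HasCliqueCover H w n) {S : Finset V}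
    (hS : Hᶜ.IsClique S) : ∑ v ∈ S, w v ≤ n := by
  have hle := h.sum_mul_le (u := incid S) (k := 1) fun K hK =>
    (sum_incid K S).trans_le (card_inter_le_one hK hS)
  simpa only [mul_comm (incid S _), sum_mul_incid, mul_one] using hle

end HasCliqueCover

theorem exists_hasCliqueCover (H : SimpleGraph V) (w : V → ℕ) : ∃ n, HasCliqueCover H w n := by
  rw [← sum_smul_incid_singleton w]
  exact ⟨_, .sum fun v _ => (HasCliqueCover.of_isClique (by simp)).nsmul (w v)⟩

end Covers

section WeightedPerfect

variable {V : Type*} [Fintype V] [DecidableEq V] {H : SimpleGraph V}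

/-- The weighted form of perfection: for all weights, the maximum weight of a clique is the
minimum size of a cover by stable sets. Stating it through upper bounds `n` for the weights of
cliques avoids naming the maximum. -/
def WeightedPerfect (H : SimpleGraph V) : Prop :=
  ∀ (w : V → ℕ) (n : ℕ), (∀ K : Finset V, H.IsClique K → ∑ v ∈ K, w v ≤ n) →
    HasCliqueCover Hᶜ w n

theorem WeightedPerfect.exists_isClique (hH : WeightedPerfect H) (w : V → ℕ) :
    ∃ K : Finset V, H.IsClique K ∧ HasCliqueCover Hᶜ w (∑ v ∈ K, w v) := by
  classical
  obtain ⟨K, hK, hmax⟩ := exists_max_image ({K | H.IsClique K} : Finset (Finset V))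
    (fun K => ∑ v ∈ K, w v) ⟨∅, by simp⟩
  rw [mem_filter_univ] at hK
  exact ⟨K, hK, hH w _ fun K' hK' => hmax K' (by rwa [mem_filter_univ])⟩

/-- If no clique met all sets of `𝒯`, then every clique would have weight less than `#𝒯` for the
weights counting the sets of `𝒯` through a vertex, so fewer than `#𝒯` stable sets would cover
these weights; but they cannot, as none of them is heavier than a set of `𝒯`. -/
theorem WeightedPerfect.exists_isClique_inter_nonempty (hH : WeightedPerfect H) {w : V → ℕ}
    {n : ℕ} (hn : 0 < n) (hw : ∀ T : Finset V, Hᶜ.IsClique T → ∑ v ∈ T, w v ≤ n)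
    {𝒯 : Finset (Finset V)} (h𝒯 : ∀ T ∈ 𝒯, Hᶜ.IsClique T) (h𝒯w : ∀ T ∈ 𝒯, ∑ v ∈ T, w v = n) :
    ∃ K : Finset V, H.IsClique K ∧ ∀ T ∈ 𝒯, (K ∩ T).Nonempty := by
  by_contra! hcon
  have clique_lt : ∀ K : Finset V, H.IsClique K → ∑ v ∈ K, (∑ T ∈ 𝒯, incid T) v < #𝒯 := by
    intro K hK
    obtain ⟨T, hT, hKT⟩ := hcon K hK
    simp_rw [Finset.sum_apply]
    rw [sum_comm, card_eq_sum_ones]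
    simp_rw [sum_incid]
    exact sum_lt_sum (fun T hT => card_inter_le_one hK (h𝒯 T hT)) ⟨T, hT, by simp [hKT]⟩
  have cover := hH (∑ T ∈ 𝒯, incid T) (#𝒯 - 1) fun K hK => Nat.le_pred_of_lt (clique_lt K hK)
  have weight : ∑ v, w v * (∑ T ∈ 𝒯, incid T) v = #𝒯 * n := by
    simp_rw [Finset.sum_apply, mul_sum]
    rw [sum_comm]
    simp_rw [sum_mul_incid]
    exact sum_const_nat h𝒯w
  have card_le : #𝒯 ≤ #𝒯 - 1 := by
    have := cover.sum_mul_le hw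
    rw [weight] at this
    exact Nat.le_of_mul_le_mul_right this hn
  have card_pos := clique_lt ∅ (by simp)
  omega

theorem WeightedPerfect.exists_isClique_meeting (hH : WeightedPerfect H) {w : V → ℕ}
    {n : ℕ} (hn : 0 < n) (hw : ∀ T : Finset V, Hᶜ.IsClique T → ∑ v ∈ T, w v ≤ n) :
    ∃ K : Finset V, H.IsClique K ∧
      ∀ T : Finset V, Hᶜ.IsClique T → ∑ v ∈ T, w v = n → ∃ v ∈ T, v ∈ K ∧ w v ≠ 0 := by
  classical
  obtain ⟨K, hK, hmeet⟩ := hH.exists_isClique_inter_nonempty hn hw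
    (𝒯 := {T | Hᶜ.IsClique T ∧ (∀ v ∈ T, w v ≠ 0) ∧ ∑ v ∈ T, w v = n})
    (fun T hT => (mem_filter.1 hT).2.1) fun T hT => (mem_filter.1 hT).2.2.2
  refine ⟨K, hK, fun T hT hTn => ?_⟩
  obtain ⟨v, hv⟩ := hmeet {v ∈ T | w v ≠ 0} <| mem_filter.2
    ⟨mem_univ _, hT.subset (coe_subset.2 (filter_subset _ _)), by simp,
      (sum_filter_ne_zero T).trans hTn⟩
  rw [mem_inter, mem_filter] at hv
  exact ⟨v, hv.2.1, hv.1, hv.2.2⟩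

/-- The weighted perfect graph theorem. -/
theorem WeightedPerfect.compl (hH : WeightedPerfect H) : WeightedPerfect Hᶜ := by
  intro w n hw
  rw [compl_compl]
  induction n generalizing w with
  | zero =>
    refine HasCliqueCover.zero.mono (fun v => ?_) le_rfl
    simpa using hw {v} (by simp)
  | succ n ih =>
    obtain ⟨K, hK, hmeet⟩ := hH.exists_isClique_meeting n.succ_pos hw
    refine (ih (w - incid K) fun T hT => ?_).of_sub_incid hK
    rcases (hw T hT).lt_or_eq with hlt | heq
    · exact (sum_le_sum fun v _ => Nat.sub_le _ _).trans (Nat.le_of_lt_succ hlt)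
    · obtain ⟨v, hvT, hvK, hv⟩ := hmeet T hT heq
      exact Nat.le_of_lt_succ ((sum_sub_incid_lt hvT hvK hv).trans_eq heq)

/-- The inductive step of the replication argument: a cover of the weights lowered by one at `v`
contains a stable set through `v` which meets all cliques that avoid `v` and are too heavy. -/
theorem exists_isClique_compl_sum_sub_incid_le {w : V → ℕ} {n : ℕ} {v : V} (hv : 2 ≤ w v)
    (hw : ∀ K : Finset V, H.IsClique K → ∑ u ∈ K, w u ≤ n)
    (hcover : HasCliqueCover Hᶜ (w - incid {v}) n) :
    ∃ (S : Finset V) (k : ℕ), Hᶜ.IsClique S ∧ v ∈ S ∧ n = k + 1 ∧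
      ∀ K : Finset V, H.IsClique K → ∑ u ∈ K, (w - incid S) u ≤ k := by
  have hv' : (w - incid {v}) v ≠ 0 := by
    rw [Pi.sub_apply, incid_of_mem (mem_singleton_self v)]
    omega
  obtain ⟨S, k, hS, hvS, rfl, hcover'⟩ := hcover.exists_sub_incid hv'
  refine ⟨S, k, hS, hvS, rfl, fun K hK => ?_⟩
  by_cases hvK : v ∈ K
  · exact Nat.le_of_lt_succ ((sum_sub_incid_lt hvK hvS (by omega)).trans_le (hw K hK))
  · refine le_trans (sum_congr rfl fun u hu => ?_).le
      (hcover'.sum_le_of_isClique_compl (by rwa [compl_compl]))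
    have huv : u ∉ ({v} : Finset V) := by
      rw [mem_singleton]
      exact ne_of_mem_of_not_mem hu hvK
    simp only [Pi.sub_apply, incid_of_notMem huv, Nat.sub_zero]

theorem weightedPerfect_of_incid
    (hH : ∀ (U : Finset V) (n : ℕ), (∀ K ⊆ U, H.IsClique K → #K ≤ n) →
      HasCliqueCover Hᶜ (incid U) n) : WeightedPerfect H := by
  intro w n hw
  induction hs : ∑ v, w v using Nat.strong_induction_on generalizing w n with
  | _ s ih =>
  subst hs
  by_cases hlarge : ∃ v, 2 ≤ w v
  · obtain ⟨v, hv⟩ := hlarge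
    have hcover : HasCliqueCover Hᶜ (w - incid {v}) n :=
      ih _ (sum_sub_incid_lt (mem_univ v) (mem_singleton_self v) (by omega)) _ n
        (fun K hK => (sum_le_sum fun u _ => Nat.sub_le _ _).trans (hw K hK)) rfl
    obtain ⟨S, k, hS, hvS, rfl, hk⟩ := exists_isClique_compl_sum_sub_incid_le hv hw hcover
    exact (ih _ (sum_sub_incid_lt (mem_univ v) hvS (by omega)) _ k hk rfl).of_sub_incid hS
  · push Not at hlarge
    have hw_eq : w = incid {v | w v ≠ 0} := by
      ext v
      have := hlarge v
      simp only [incid, mem_filter_univ]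
      split_ifs <;> omega
    rw [hw_eq]
    refine hH _ n fun K hKU hK => le_trans (Eq.le ?_) (hw K hK)
    rw [sum_congr rfl fun v _ => congrFun hw_eq v, sum_incid, inter_eq_left.2 hKU]

theorem HasCliqueCover.of_colorable_induce {U : Finset V} {n : ℕ}
    (hU : (H.induce (U : Set V)).Colorable n) : HasCliqueCover Hᶜ (incid U) n := by
  obtain ⟨C⟩ := hU
  let colorClass (c : Fin n) : Finset V :=
    ({u | C u = c} : Finset (U : Set V)).map (.subtype _)
  have hstable (c : Fin n) : Hᶜ.IsClique (colorClass c) := by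
    intro u hu v hv huv
    simp only [colorClass, coe_map, Set.mem_image, mem_coe, mem_filter_univ] at hu hv
    obtain ⟨u, huc, rfl⟩ := hu
    obtain ⟨v, hvc, rfl⟩ := hv
    exact ⟨huv, fun hadj => C.valid (v := u) (w := v) hadj (huc.trans hvc.symm)⟩
  refine (HasCliqueCover.sum (s := univ) fun c _ => .of_isClique (hstable c)).mono
    (fun v => ?_) (by simp)
  by_cases hv : v ∈ U
  · have hmem : v ∈ colorClass (C ⟨v, hv⟩) := by simpa [colorClass] using hv
    rw [incid_of_mem hv, ← incid_of_mem hmem, Finset.sum_apply]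
    exact single_le_sum (f := fun c => incid (colorClass c) v) (fun _ _ => Nat.zero_le _)
      (mem_univ _)
  · rw [incid_of_notMem hv]
    exact Nat.zero_le _

theorem HasCliqueCover.colorable_induce {w : V → ℕ} {n : ℕ} (h : HasCliqueCover Hᶜ w n)
    {U : Set V} (hU : ∀ v ∈ U, w v ≠ 0) : (H.induce U).Colorable n := by
  obtain ⟨m, hm, hmn⟩ := h
  choose S hvS hS using fun v : U => hm.exists_mem (hU v v.2)
  let C : (H.induce U).Coloring {S : Finset V // m S ≠ 0} :=
    SimpleGraph.Coloring.mk (fun v => ⟨S v, hS v⟩) fun {u v} huv hSuv =>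
      have hSuv : S u = S v := congrArg Subtype.val hSuv
      (hm.isClique _ (hS v) (hSuv ▸ hvS u) (hvS v) (Subtype.coe_injective.ne huv.ne)).2 huv
  refine C.colorable.mono (le_trans ?_ hmn)
  rw [Fintype.card_subtype, card_eq_sum_ones, ← sum_filter_ne_zero (f := m)]
  exact sum_le_sum fun S hS => Nat.one_le_iff_ne_zero.2 (mem_filter.1 hS).2

theorem IsPerfect.weightedPerfect (hH : IsPerfect H) : WeightedPerfect H := by
  refine weightedPerfect_of_incid fun U n hU => .of_colorable_induce <|
    SimpleGraph.chromaticNumber_le_iff_colorable.1 ?_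
  obtain ⟨K, hK⟩ := (H.induce (U : Set V)).exists_isNClique_cliqueNum
  rw [← hH U, Nat.cast_le, ← hK.card_eq, ← card_map (.subtype _)]
  refine hU _ (fun v hv => ?_) ?_
  · obtain ⟨u, -, rfl⟩ := mem_map.1 hv
    exact u.2
  · simpa using SimpleGraph.isClique_induce_iff.1 hK.isClique

theorem WeightedPerfect.isPerfect (hH : WeightedPerfect H) : IsPerfect H := by
  classical
  refine fun U => le_antisymm (SimpleGraph.cliqueNum_le_chromaticNumber) ?_
  refine SimpleGraph.chromaticNumber_le_iff_colorable.2 <|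
    (hH (incid {v | v ∈ U}) _ fun K hK => ?_).colorable_induce (U := U) fun v hv => ?_
  · rw [sum_incid, inter_filter, inter_univ, ← card_subtype]
    refine SimpleGraph.IsClique.card_le_cliqueNum (tc := ?_)
    rw [SimpleGraph.isClique_induce_iff]
    refine hK.subset ?_
    rintro _ ⟨v, hv, rfl⟩
    exact mem_subtype.1 hv
  · rw [incid_of_mem (by simpa using hv)]
    exact one_ne_zero

end WeightedPerfect

section Sublinear

open Filter

variable {M : Type*} [AddCommMonoid M]

/-- A functional on an additive monoid that is monotone for the preorder in which `u` is below
`u + v`, subadditive, and homogeneous. -/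
structure IsSublinear (f : M → ℕ) : Prop where
  le_add_right : ∀ u v, f u ≤ f (u + v)
  add_le : ∀ u v, f (u + v) ≤ f u + f v
  nsmul : ∀ (k : ℕ) u, f (k • u) = k * f u

/-- The elements along which `f` is additive. -/
def IsSublinear.additiveAlong {f : M → ℕ} (hf : IsSublinear f) : AddSubmonoid M where
  carrier := {a | ∀ u, f (u + a) = f u + f a}
  zero_mem' u := by simpa using hf.nsmul 0 0
  add_mem' {a b} ha hb u := by
    have hab : f (a + b) = f a + f b := hb a
    rw [← add_assoc, hb, ha, hab, add_assoc]

/-- The limit of `f (N • a + u) - N * f a` for large `N`, which is the largest functional below `f`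
that takes the value `f a` at `a` and is additive along `a`. -/
noncomputable def asymptoticIncrement (f : M → ℕ) (a u : M) : ℕ :=
  ⨅ N : ℕ, (f (N • a + u) - N * f a)

theorem asymptoticIncrement_le (f : M → ℕ) (a u : M) : asymptoticIncrement f a u ≤ f u :=
  (ciInf_le (OrderBot.bddBelow _) 0).trans_eq (by simp)

namespace IsSublinear

variable {f : M → ℕ}

theorem map_zero (hf : IsSublinear f) : f 0 = 0 := by
  simpa using hf.nsmul 0 0

theorem mem_additiveAlong_of_forall_add (hf : IsSublinear f) {b : M} {n : ℕ}
    (hb : ∀ u, f (u + b) = f u + n) : b ∈ hf.additiveAlong ∧ f b = n := by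
  have hval : f b = n := by simpa [hf.map_zero] using hb 0
  exact ⟨fun u => by rw [hb, hval], hval⟩

theorem mul_le_nsmul_add (hf : IsSublinear f) (N : ℕ) (a u : M) : N * f a ≤ f (N • a + u) :=
  (hf.nsmul N a).symm.trans_le (hf.le_add_right _ _)

theorem antitone_nsmul_add_sub (hf : IsSublinear f) (a u : M) :
    Antitone fun N : ℕ => f (N • a + u) - N * f a := by
  refine antitone_nat_of_succ_le fun N => ?_
  have hle : f ((N + 1) • a + u) ≤ f (N • a + u) + f a := by
    rw [succ_nsmul, add_right_comm]
    exact hf.add_le _ _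
  rw [add_one_mul]
  omega

theorem eventually_nsmul_add (hf : IsSublinear f) (a u : M) :
    ∀ᶠ N : ℕ in atTop, f (N • a + u) = N * f a + asymptoticIncrement f a u := by
  have hlim := tendsto_atTop_ciInf (hf.antitone_nsmul_add_sub a u) (OrderBot.bddBelow _)
  rw [nhds_discrete, tendsto_pure] at hlim
  filter_upwards [hlim] with N hN
  have := hf.mul_le_nsmul_add N a u
  rw [asymptoticIncrement, ← hN]
  omega

theorem asymptoticIncrement_add_self (hf : IsSublinear f) (a u : M) :
    asymptoticIncrement f a (u + a) = asymptoticIncrement f a u + f a := by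
  obtain ⟨N, hN, hN'⟩ := ((hf.eventually_nsmul_add a (u + a)).and
    ((tendsto_add_atTop_nat 1).eventually (hf.eventually_nsmul_add a u))).exists
  rw [succ_nsmul, add_assoc, add_comm a u, hN, add_one_mul] at hN'
  omega

theorem asymptoticIncrement_add_of_mem (hf : IsSublinear f) {b : M} (hb : b ∈ hf.additiveAlong)
    (a u : M) : asymptoticIncrement f a (u + b) = asymptoticIncrement f a u + f b := by
  obtain ⟨N, hN, hN'⟩ :=
    ((hf.eventually_nsmul_add a u).and (hf.eventually_nsmul_add a (u + b))).exists
  rw [← add_assoc, hb, hN] at hN'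
  omega

protected theorem asymptoticIncrement (hf : IsSublinear f) (a : M) :
    IsSublinear (asymptoticIncrement f a) where
  le_add_right u v := by
    obtain ⟨N, hN, hN'⟩ :=
      ((hf.eventually_nsmul_add a u).and (hf.eventually_nsmul_add a (u + v))).exists
    have := hf.le_add_right (N • a + u) v
    rw [add_assoc] at this
    omega
  add_le u v := by
    obtain ⟨N, hu, hv, huv⟩ := ((hf.eventually_nsmul_add a u).and
      ((hf.eventually_nsmul_add a v).and ((tendsto_id.const_mul_atTop' two_pos).eventually
        (hf.eventually_nsmul_add a (u + v))))).exists
    have := hf.add_le (N • a + u) (N • a + v)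
    rw [id, two_mul, add_nsmul, add_add_add_comm] at huv
    rw [huv, hu, hv, add_mul] at this
    omega
  nsmul k u := by
    rcases Nat.eq_zero_or_pos k with rfl | hk
    · simpa [hf.map_zero] using asymptoticIncrement_le f a 0
    · obtain ⟨N, hN, hN'⟩ := ((hf.eventually_nsmul_add a u).and
        ((tendsto_id.const_mul_atTop' hk).eventually
          (hf.eventually_nsmul_add a (k • u)))).exists
      rw [id, mul_nsmul', ← nsmul_add, hf.nsmul, hN, mul_add, mul_assoc] at hN'
      omega

theorem self_mem_additiveAlong_asymptoticIncrement (hf : IsSublinear f) (a : M) :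
    a ∈ (hf.asymptoticIncrement a).additiveAlong ∧ asymptoticIncrement f a a = f a :=
  (hf.asymptoticIncrement a).mem_additiveAlong_of_forall_add (hf.asymptoticIncrement_add_self a)

theorem mem_additiveAlong_asymptoticIncrement (hf : IsSublinear f) {b : M}
    (hb : b ∈ hf.additiveAlong) (a : M) :
    b ∈ (hf.asymptoticIncrement a).additiveAlong ∧ asymptoticIncrement f a b = f b :=
  (hf.asymptoticIncrement a).mem_additiveAlong_of_forall_add
    (hf.asymptoticIncrement_add_of_mem hb a)

theorem exists_isSublinear_subset_additiveAlong (hf : IsSublinear f) (s : Finset M) :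
    ∃ (g : M → ℕ) (hg : IsSublinear g), (∀ u, g u ≤ f u) ∧ ↑s ⊆ (hg.additiveAlong : Set M) ∧
      ∀ b ∈ hf.additiveAlong, b ∈ hg.additiveAlong ∧ g b = f b := by
  classical
  induction s using Finset.induction_on with
  | empty => exact ⟨f, hf, fun _ => le_rfl, by simp, fun b hb => ⟨hb, rfl⟩⟩
  | insert a s _ ih =>
    obtain ⟨g, hg, hgf, hs, hfg⟩ := ih
    refine ⟨asymptoticIncrement g a, hg.asymptoticIncrement a,
      fun u => (asymptoticIncrement_le g a u).trans (hgf u), ?_, fun b hb => ?_⟩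
    · rw [coe_insert, Set.insert_subset_iff]
      exact ⟨(hg.self_mem_additiveAlong_asymptoticIncrement a).1,
        fun b hb => (hg.mem_additiveAlong_asymptoticIncrement (hs hb) a).1⟩
    · obtain ⟨hbg, hval⟩ := hfg b hb
      obtain ⟨hbi, hval'⟩ := hg.mem_additiveAlong_asymptoticIncrement hbg a
      exact ⟨hbi, hval'.trans hval⟩

/-- A discrete Hahn–Banach theorem. -/
theorem exists_addMonoidHom [AddMonoid.FG M] (hf : IsSublinear f) (w : M) :
    ∃ g : M →+ ℕ, (∀ u, g u ≤ f u) ∧ g w = f w := by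
  obtain ⟨s, hs⟩ := AddMonoid.FG.fg_top (M := M)
  obtain ⟨g, hg, hgf, hsg, hfg⟩ :=
    (hf.asymptoticIncrement w).exists_isSublinear_subset_additiveAlong s
  have hadd (u v : M) : g (u + v) = g u + g v := by
    have hv : v ∈ hg.additiveAlong := AddSubmonoid.closure_le.2 hsg (hs ▸ AddSubmonoid.mem_top v)
    exact hv u
  refine ⟨⟨⟨g, hg.map_zero⟩, hadd⟩, fun u => (hgf u).trans (asymptoticIncrement_le f w u), ?_⟩
  obtain ⟨hw, hval⟩ := hf.self_mem_additiveAlong_asymptoticIncrement w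
  exact (hfg w hw).2.trans hval

end IsSublinear

end Sublinear

section CliqueCoverNum

variable {V : Type*} [Fintype V] [DecidableEq V] {G : SimpleGraph V} {w : V → ℕ} {n : ℕ}

/-- The minimum size of a clique cover of the weights `w`. -/
noncomputable def cliqueCoverNum (G : SimpleGraph V) (w : V → ℕ) : ℕ :=
  sInf {n | HasCliqueCover G w n}

theorem cliqueCoverNum_le (h : HasCliqueCover G w n) : cliqueCoverNum G w ≤ n := Nat.sInf_le h

theorem hasCliqueCover_cliqueCoverNum (G : SimpleGraph V) (w : V → ℕ) :
    HasCliqueCover G w (cliqueCoverNum G w) :=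
  Nat.sInf_mem (exists_hasCliqueCover G w)

theorem isSublinear_cliqueCoverNum
    (h : ∀ (k : ℕ) w, k * cliqueCoverNum G w ≤ cliqueCoverNum G (k • w)) :
    IsSublinear (cliqueCoverNum G) where
  le_add_right u v :=
    cliqueCoverNum_le ((hasCliqueCover_cliqueCoverNum G (u + v)).mono le_self_add le_rfl)
  add_le u v :=
    cliqueCoverNum_le ((hasCliqueCover_cliqueCoverNum G u).add (hasCliqueCover_cliqueCoverNum G v))
  nsmul k u :=
    (cliqueCoverNum_le ((hasCliqueCover_cliqueCoverNum G u).nsmul k)).antisymm (h k u)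

theorem sum_map_incid_singleton_le_one {g : (V → ℕ) →+ ℕ} (hg : ∀ u, g u ≤ cliqueCoverNum G u)
    {K : Finset V} (hK : G.IsClique K) : ∑ v ∈ K, g (incid {v}) ≤ 1 := by
  rw [← map_sum, ← incid_eq_sum]
  exact (hg _).trans (cliqueCoverNum_le (.of_isClique hK))

/-- An integral linear functional below the clique cover number is the incidence vector of a
stable set. -/
theorem weightedPerfect_compl_of_isSublinear (h : IsSublinear (cliqueCoverNum G)) :
    WeightedPerfect Gᶜ := by
  intro w n hw
  obtain ⟨g, hg, hgw⟩ := h.exists_addMonoidHom w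
  have hstable : Gᶜ.IsClique ({v | g (incid {v}) ≠ 0} : Finset V) := by
    intro u hu v hv huv
    refine ⟨huv, fun hadj => ?_⟩
    have hsum := sum_map_incid_singleton_le_one hg (K := {u, v})
      (by simpa [SimpleGraph.isClique_pair] using fun _ => hadj)
    rw [sum_pair huv] at hsum
    rw [mem_coe, mem_filter_univ] at hu hv
    omega
  rw [compl_compl]
  refine (hasCliqueCover_cliqueCoverNum G w).mono le_rfl ?_
  calc cliqueCoverNum G w = ∑ v, w v * g (incid {v}) := by
        rw [← hgw]
        conv_lhs => rw [← sum_smul_incid_singleton w]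
        simp_rw [map_sum, map_nsmul, smul_eq_mul]
    _ = ∑ v with g (incid {v}) ≠ 0, w v * g (incid {v}) :=
        (sum_filter_of_ne fun v _ => right_ne_zero_of_mul).symm
    _ ≤ ∑ v with g (incid {v}) ≠ 0, w v := sum_le_sum fun v _ => by
        have hv : g (incid {v}) ≤ 1 := by
          simpa using sum_map_incid_singleton_le_one hg (K := {v}) (by simp)
        simpa using Nat.mul_le_mul_left (w v) hv
    _ ≤ n := hw _ hstable

end CliqueCoverNum

section DualSlack

variable {V : Type*}

/-- The slacks of the dual program with objective `Diag(0 ⊕ c)`, whose entries are restricted to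
`A` at the edges of `G` and to `B` at the other pairs of distinct vertices. -/
structure IsDualSlack (G : SimpleGraph V) (A B : Set ℝ) (c : V → ℝ)
    (S : Matrix (Option V) (Option V) ℝ) : Prop where
  posSemidef : S.PosSemidef
  le_diag : ∀ j, c j ≤ -2 * S none (some j) - S (some j) (some j)
  of_adj : ∀ i j, G.Adj i j → S (some i) (some j) ∈ A
  of_compl_adj : ∀ i j, Gᶜ.Adj i j → S (some i) (some j) ∈ B

/-- The common properties of the entry restrictions of the three formulations. They make all
clique covers dual solutions, and all stable sets primal solutions. -/
structure IsAdmissible (A B : Set ℝ) : Prop where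
  isClosed_left : IsClosed A
  isClosed_right : IsClosed B
  nonneg_mem : ∀ s, 0 ≤ s → s ∈ A
  zero_mem : 0 ∈ B
  nonpos : ∀ s ∈ B, s ≤ 0

variable {G : SimpleGraph V} {A B : Set ℝ} {c : V → ℝ} {S : Matrix (Option V) (Option V) ℝ}

section CoverSlack

variable [Fintype V] [DecidableEq V] {w : V → ℕ} {m : Finset V → ℕ}

/-- The integral slack `∑ K, m K ((-1) ⊕ 𝟙_K) ((-1) ⊕ 𝟙_K)ᵀ` given by the multiplicities `m`. -/
noncomputable def coverSlack (m : Finset V → ℕ) : Matrix (Option V) (Option V) ℝ :=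
  ∑ K : Finset V, (m K : ℝ) • Matrix.vecMulVec (negIncid K) (negIncid K)

theorem coverSlack_apply (m : Finset V → ℕ) (i j : Option V) :
    coverSlack m i j = ∑ K, m K * (negIncid K i * negIncid K j) := by
  simp [coverSlack, Matrix.sum_apply, Matrix.vecMulVec_apply]

theorem coverSlack_none_none (m : Finset V → ℕ) : coverSlack m none none = ∑ K, (m K : ℝ) := by
  simp [coverSlack_apply, negIncid]

theorem coverSlack_none_some (m : Finset V → ℕ) (j : V) :
    coverSlack m none (some j) = -coverage m j := by
  rw [coverSlack_apply, coverage_apply, Nat.cast_sum, sum_filter, ← sum_neg_distrib]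
  refine sum_congr rfl fun K _ => ?_
  by_cases h : j ∈ K <;> simp [negIncid, h]

theorem coverSlack_some_some (m : Finset V → ℕ) (i j : V) :
    coverSlack m (some i) (some j) = ∑ K with i ∈ K ∧ j ∈ K, (m K : ℝ) := by
  simp [coverSlack_apply, negIncid, sum_filter, ← ite_and, and_comm]

theorem coverSlack_diag (m : Finset V → ℕ) (j : V) :
    coverSlack m (some j) (some j) = coverage m j := by
  simp [coverSlack_some_some, coverage_apply]

theorem coverSlack_mem_intRange (m : Finset V → ℕ) (i j : Option V) :
    coverSlack m i j ∈ (Int.castRingHom ℝ).range := by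
  have hincid (K : Finset V) (i : Option V) : negIncid K i ∈ (Int.castRingHom ℝ).range := by
    rcases i with _ | v
    · exact neg_mem (one_mem _)
    · exact ite_mem.2 ⟨fun _ => one_mem _, fun _ => zero_mem _⟩
  rw [coverSlack_apply]
  exact sum_mem fun K _ => mul_mem (natCast_mem _ _) (mul_mem (hincid K i) (hincid K j))

theorem posSemidef_coverSlack (m : Finset V → ℕ) : (coverSlack m).PosSemidef :=
  Matrix.posSemidef_sum _ fun K _ => Matrix.PosSemidef.smul
    (by simpa using Matrix.posSemidef_vecMulVec_self_star (negIncid K)) (Nat.cast_nonneg _)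

theorem IsCliqueCover.isDualSlack_smul (hAB : IsAdmissible A B) (hm : IsCliqueCover G w m)
    {t : ℝ} (ht : 0 ≤ t) (hc : ∀ j, c j ≤ t * w j) :
    IsDualSlack G A B c (t • coverSlack m) where
  posSemidef := (posSemidef_coverSlack m).smul ht
  le_diag j := by
    have hle : (w j : ℝ) ≤ coverage m j := Nat.cast_le.2 (hm.le_coverage j)
    simp only [Matrix.smul_apply, smul_eq_mul, coverSlack_none_some, coverSlack_diag]
    linarith [hc j, mul_le_mul_of_nonneg_left hle ht]
  of_adj i j _ := by
    rw [Matrix.smul_apply, coverSlack_some_some]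
    exact hAB.nonneg_mem _ (smul_nonneg ht (sum_nonneg fun K _ => Nat.cast_nonneg _))
  of_compl_adj i j hij := by
    have hzero : ∀ K ∈ ({K | i ∈ K ∧ j ∈ K} : Finset (Finset V)), (m K : ℝ) = 0 := by
      intro K hK
      rw [mem_filter_univ] at hK
      by_contra hmK
      exact hij.2 (hm.isClique K (Nat.cast_ne_zero.1 hmK) hK.1 hK.2 hij.1)
    rw [Matrix.smul_apply, coverSlack_some_some, sum_eq_zero hzero, smul_zero]
    exact hAB.zero_mem

theorem IsDualSlack.isCliqueCover (hAB : IsAdmissible A B)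
    (hS : IsDualSlack G A B (fun v => w v) (coverSlack m)) : IsCliqueCover G w m where
  isClique K hK i hi j hj hij := by
    by_contra hadj
    have hle := hAB.nonpos _ (hS.of_compl_adj i j ⟨hij, hadj⟩)
    rw [coverSlack_some_some] at hle
    have hmK : (m K : ℝ) ≤ 0 := (single_le_sum (f := fun K => (m K : ℝ))
      (fun _ _ => Nat.cast_nonneg _) (mem_filter_univ K |>.2 ⟨hi, hj⟩)).trans hle
    exact hK (Nat.le_zero.1 (by exact_mod_cast hmK))
  le_coverage j := by
    have hle := hS.le_diag j
    rw [coverSlack_none_some, coverSlack_diag] at hle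
    have hcast : (w j : ℝ) ≤ coverage m j := by linarith
    exact_mod_cast hcast

end CoverSlack

/-- Weak duality against the primal solution `(1 ⊕ 𝟙_T) (1 ⊕ 𝟙_T)ᵀ` given by `T`. -/
theorem IsDualSlack.sum_le_of_isClique_compl [Finite V] (hAB : IsAdmissible A B)
    (hS : IsDualSlack G A B c S) {T : Finset V} (hT : Gᶜ.IsClique T) :
    ∑ j ∈ T, c j ≤ S none none := by
  classical
  have := Fintype.ofFinite V
  have hsymm (j : V) : S (some j) none = S none (some j) := by
    simpa using hS.posSemidef.isHermitian.apply none (some j)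
  have hquad : 0 ≤ S none none + 2 * ∑ j ∈ T, S none (some j) +
      ∑ i ∈ T, ∑ j ∈ T, S (some i) (some j) := by
    refine (hS.posSemidef.dotProduct_mulVec_nonneg
      (fun i => Option.elim i 1 fun v => if v ∈ T then 1 else 0)).trans_eq ?_
    simp only [dotProduct, Pi.star_apply, star_trivial, Matrix.mulVec, Fintype.sum_option,
      Option.elim_none, mul_one, Option.elim_some, mul_ite, mul_zero, sum_ite_mem, univ_inter,
      one_mul, hsymm, ite_mul, zero_mul, sum_add_distrib]
    ring
  have hoff (i : V) (hi : i ∈ T) : ∑ j ∈ T, S (some i) (some j) ≤ S (some i) (some i) := by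
    rw [← add_sum_erase T _ hi, add_le_iff_nonpos_right]
    refine sum_nonpos fun j hj => hAB.nonpos _ (hS.of_compl_adj i j ?_)
    exact hT hi (mem_of_mem_erase hj) (ne_of_mem_erase hj).symm
  have hdiag := sum_le_sum fun j (_ : j ∈ T) => hS.le_diag j
  rw [sum_sub_distrib, ← mul_sum] at hdiag
  linarith [sum_le_sum hoff]

theorem IsDualSlack.sum_toNat_le_of_isClique_compl [Finite V] {c : V → ℤ} (hAB : IsAdmissible A B)
    (hS : IsDualSlack G A B (fun v => c v) S) {T : Finset V} (hT : Gᶜ.IsClique T) :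
    ((∑ j ∈ T, (c j).toNat : ℕ) : ℝ) ≤ S none none := by
  have hsum : ((∑ j ∈ T, (c j).toNat : ℕ) : ℤ) = ∑ j ∈ T with 0 ≤ c j, c j := by
    rw [sum_filter, Nat.cast_sum]
    refine sum_congr rfl fun v _ => ?_
    split_ifs with h <;> omega
  have hle := hS.sum_le_of_isClique_compl hAB
    (hT.subset (coe_subset.2 (filter_subset (fun j => 0 ≤ c j) T)))
  rw [← Int.cast_natCast, hsum, Int.cast_sum]
  exact hle

theorem quadratic_nonneg_of_posSemidef {n : Type*} {S : Matrix n n ℝ} (hS : S.PosSemidef)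
    (i j : n) (a b : ℝ) : 0 ≤ a ^ 2 * S i i + 2 * a * b * S i j + b ^ 2 * S j j := by
  have hsymm : S j i = S i j := by simpa using hS.isHermitian.apply i j
  refine ((hS.submatrix ![i, j]).dotProduct_mulVec_nonneg ![a, b]).trans_eq ?_
  simp only [dotProduct, Pi.star_apply, star_trivial, Matrix.mulVec, Matrix.submatrix_apply,
    Fin.sum_univ_two, Matrix.cons_val_zero, Matrix.cons_val_one, hsymm]
  ring

theorem abs_apply_le_of_posSemidef {n : Type*} {S : Matrix n n ℝ} (hS : S.PosSemidef) {r : ℝ}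
    (hr : ∀ i, S i i ≤ r) (i j : n) : |S i j| ≤ r := by
  have hadd := quadratic_nonneg_of_posSemidef hS i j 1 1
  have hsub := quadratic_nonneg_of_posSemidef hS i j 1 (-1)
  rw [abs_le]
  constructor <;> linarith [hr i, hr j]

theorem IsDualSlack.abs_apply_le [Fintype V] (hS : IsDualSlack G A B c S) {r : ℝ}
    (hr : S none none ≤ r) (i j : Option V) : |S i j| ≤ 4 * r + 2 * ∑ v, |c v| := by
  refine abs_apply_le_of_posSemidef hS.posSemidef (fun i => ?_) i j
  rcases i with _ | v
  · have h0 : 0 ≤ S none none := hS.posSemidef.diag_nonneg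
    have hc : 0 ≤ ∑ v, |c v| := sum_nonneg fun v _ => abs_nonneg (c v)
    linarith
  · have hc : |c v| ≤ ∑ v, |c v| :=
      single_le_sum (f := fun v => |c v|) (fun _ _ => abs_nonneg _) (mem_univ v)
    linarith [quadratic_nonneg_of_posSemidef hS.posSemidef none (some v) 2 1, hS.le_diag v,
      neg_abs_le (c v)]

theorem isClosed_setOf_posSemidef {n : Type*} [Finite n] :
    IsClosed {S : Matrix n n ℝ | S.PosSemidef} := by
  have := Fintype.ofFinite n
  simp only [Matrix.posSemidef_iff_dotProduct_mulVec, Set.ofPred_and, Set.ofPred_forall]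
  refine (isClosed_eq ?_ continuous_id).inter
    (isClosed_iInter fun x => isClosed_le continuous_const ?_) <;> fun_prop

theorem isClosed_setOf_isDualSlack [Finite V] (hAB : IsAdmissible A B) :
    IsClosed {S | IsDualSlack G A B c S} := by
  have hiff (S) : IsDualSlack G A B c S ↔ S.PosSemidef ∧
      (∀ j, c j ≤ -2 * S none (some j) - S (some j) (some j)) ∧
      (∀ i j, G.Adj i j → S (some i) (some j) ∈ A) ∧
      ∀ i j, Gᶜ.Adj i j → S (some i) (some j) ∈ B :=
    ⟨fun ⟨h₁, h₂, h₃, h₄⟩ => ⟨h₁, h₂, h₃, h₄⟩, fun ⟨h₁, h₂, h₃, h₄⟩ => ⟨h₁, h₂, h₃, h₄⟩⟩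
  have hentry (i j : Option V) : Continuous fun S : Matrix (Option V) (Option V) ℝ => S i j :=
    continuous_id.matrix_elem i j
  simp only [hiff, Set.ofPred_and, Set.ofPred_forall]
  refine isClosed_setOf_posSemidef.inter (.inter ?_ (.inter ?_ ?_))
  · exact isClosed_iInter fun j => isClosed_le continuous_const (by fun_prop)
  · exact isClosed_iInter fun i => isClosed_iInter fun j => isClosed_iInter fun _ =>
      hAB.isClosed_left.preimage (hentry _ _)
  · exact isClosed_iInter fun i => isClosed_iInter fun j => isClosed_iInter fun _ =>
      hAB.isClosed_right.preimage (hentry _ _)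

theorem exists_isDualSlack [Finite V] (G : SimpleGraph V) (hAB : IsAdmissible A B) (c : V → ℝ) :
    ∃ S, IsDualSlack G A B c S := by
  classical
  have := Fintype.ofFinite V
  obtain ⟨n, m, hm, -⟩ := exists_hasCliqueCover G fun v => ⌈c v⌉₊
  exact ⟨_, hm.isDualSlack_smul hAB zero_le_one fun j => (Nat.le_ceil (c j)).trans_eq
    (one_mul _).symm⟩

theorem exists_isDualSlack_forall_le [Finite V] (G : SimpleGraph V) (hAB : IsAdmissible A B)
    (c : V → ℝ) :
    ∃ S, IsDualSlack G A B c S ∧ ∀ S', IsDualSlack G A B c S' → S none none ≤ S' none none := by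
  have := Fintype.ofFinite V
  obtain ⟨S₀, hS₀⟩ := exists_isDualSlack G hAB c
  let r := 4 * S₀ none none + 2 * ∑ v, |c v|
  let box : Set (Matrix (Option V) (Option V) ℝ) :=
    .pi .univ fun _ => .pi .univ fun _ => .Icc (-r) r
  have hcompact : IsCompact ({S | IsDualSlack G A B c S} ∩ box) :=
    (isCompact_univ_pi fun _ => isCompact_univ_pi fun _ => isCompact_Icc).inter_left
      (isClosed_setOf_isDualSlack hAB)
  have hbox {S} (hS : IsDualSlack G A B c S) (hle : S none none ≤ S₀ none none) : S ∈ box :=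
    fun i _ j _ => abs_le.1 (hS.abs_apply_le hle i j)
  obtain ⟨S, ⟨hS, -⟩, hmin⟩ := hcompact.exists_isMinOn ⟨S₀, hS₀, hbox hS₀ le_rfl⟩
    (continuous_id.matrix_elem none none).continuousOn
  refine ⟨S, hS, fun S' hS' => ?_⟩
  rcases le_total (S' none none) (S₀ none none) with hle | hge
  · exact hmin ⟨hS', hbox hS' hle⟩
  · exact (hmin ⟨hS₀, hbox hS₀ le_rfl⟩).trans hge

end DualSlack

section Combinations

open scoped Pointwise

variable {M ι κ : Type*} [AddCommGroup M] [Module ℝ M] [Fintype ι] [Fintype κ]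

/-- The linear combinations of the family `A` with all coefficients in `X`. -/
def combinations (A : ι → M) (X : Set ℝ) : Set M :=
  {m | ∃ y : ι → ℝ, (∀ i, y i ∈ X) ∧ ∑ i, y i • A i = m}

theorem combinations_sumElim (A : ι → M) (B : κ → M) (X : Set ℝ) :
    combinations (Sum.elim A B) X = combinations A X + combinations B X := by
  ext m
  constructor
  · rintro ⟨y, hy, rfl⟩
    rw [Fintype.sum_sum_type]
    exact Set.add_mem_add ⟨_, fun i => hy (.inl i), rfl⟩ ⟨_, fun k => hy (.inr k), rfl⟩
  · rintro ⟨_, ⟨y, hy, rfl⟩, _, ⟨z, hz, rfl⟩, rfl⟩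
    exact ⟨Sum.elim y z, Sum.forall.2 ⟨hy, hz⟩, by simp [Fintype.sum_sum_type]⟩

theorem combinations_neg (A : ι → M) (X : Set ℝ) :
    combinations (fun i => -A i) X = combinations A (-X) := by
  ext m
  constructor <;> rintro ⟨y, hy, rfl⟩ <;> exact ⟨-y, fun i => by simpa using hy i, by simp⟩

theorem combinations_add (A : ι → M) (X Y : Set ℝ) :
    combinations A (X + Y) = combinations A X + combinations A Y := by
  ext m
  constructor
  · rintro ⟨y, hy, rfl⟩
    choose x hx z hz hxz using hy
    exact ⟨_, ⟨x, hx, rfl⟩, _, ⟨z, hz, rfl⟩, by simp [← hxz, add_smul, sum_add_distrib]⟩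
  · rintro ⟨_, ⟨x, hx, rfl⟩, _, ⟨z, hz, rfl⟩, rfl⟩
    exact ⟨x + z, fun i => Set.add_mem_add (hx i) (hz i), by simp [add_smul, sum_add_distrib]⟩

theorem combinations_singleton_zero (A : ι → M) : combinations A {0} = 0 := by
  ext m
  constructor
  · rintro ⟨y, hy, rfl⟩
    simp [Set.mem_singleton_iff.1 (hy _)]
  · rintro rfl
    exact ⟨0, fun _ => rfl, by simp⟩

end Combinations

section Cones

open scoped Pointwise

variable {V ι κ : Type*} [Fintype ι] [Fintype κ]

/-- The combinations of the constraint matrices of `Sys` with nonnegative coefficients in `R`,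
so that `R = ⊤` describes all dual solutions and the integers `R` describe the integral ones. -/
def SDPSystem.cone (Sys : SDPSystem V ι) (R : Subring ℝ) : Set (SymHat V) :=
  combinations Sys.A (R ∩ Set.Ici 0)

theorem SDPSystem.cone_append (S : SDPSystem V ι) (T : SDPSystem V κ) (R : Subring ℝ) :
    (S.append T).cone R = S.cone R + T.cone R :=
  combinations_sumElim _ _ _

theorem SDPSystem.cone_le (A : ι → SymHat V) (b : ι → ℝ) (R : Subring ℝ) :
    (SDPSystem.le A b).cone R = combinations A (R ∩ Set.Ici 0) :=
  rfl

theorem SDPSystem.cone_ge (A : ι → SymHat V) (b : ι → ℝ) (R : Subring ℝ) :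
    (SDPSystem.ge A b).cone R = combinations A (R ∩ Set.Iic 0) := by
  have hneg : -((R : Set ℝ) ∩ Set.Ici 0) = (R : Set ℝ) ∩ Set.Iic 0 := by ext; simp
  rw [← hneg]
  exact combinations_neg _ _

theorem SDPSystem.cone_eq (A : ι → SymHat V) (b : ι → ℝ) (R : Subring ℝ) :
    (SDPSystem.eq A b).cone R = combinations A R := by
  have hsplit : (R : Set ℝ) = (R : Set ℝ) ∩ Set.Ici 0 + (R : Set ℝ) ∩ Set.Iic 0 := by
    ext x
    constructor
    · intro hx
      rcases le_total 0 x with h | h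
      · exact ⟨x, ⟨hx, h⟩, 0, by simp, add_zero x⟩
      · exact ⟨0, by simp, x, ⟨hx, h⟩, zero_add x⟩
    · rintro ⟨a, ha, b, hb, rfl⟩
      exact add_mem ha.1 hb.1
  rw [SDPSystem.eq, cone_append, cone_le, cone_ge, ← combinations_add, ← hsplit]

end Cones

section Entries

variable {V : Type*}

theorem SymHat.apply_comm (M : SymHat V) (i j : Option V) : M.1 i j = M.1 j i :=
  congrFun (congrFun M.2.symm i) j

theorem SymHat.ext_upper {M N : SymHat V} (h00 : M.1 none none = N.1 none none)
    (h0 : ∀ j, M.1 none (some j) = N.1 none (some j))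
    (h : ∀ i j, M.1 (some i) (some j) = N.1 (some i) (some j)) : M = N := by
  refine Subtype.ext (Matrix.ext fun i j => ?_)
  rcases i with _ | i <;> rcases j with _ | j
  exacts [h00, h0 j, by rw [SymHat.apply_comm M, SymHat.apply_comm N, h0], h i j]

theorem SymHat.coe_sum_smul_apply {ι : Type*} [Fintype ι] (y : ι → ℝ) (A : ι → SymHat V)
    (i j : Option V) : (∑ k, y k • A k).1 i j = ∑ k, y k * (A k).1 i j := by
  simp [Matrix.sum_apply]

variable [DecidableEq V]

theorem pairMat_apply_none (p : Sym2 V) (j : Option V) : (pairMat p).1 none j = 0 := by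
  induction p with
  | _ a b => simp [pairMat, twoSym, e, Matrix.vecMulVec_apply]

theorem pairMat_apply_some {p : Sym2 V} (hp : ¬p.IsDiag) (i j : V) :
    (pairMat p).1 (some i) (some j) = if p = s(i, j) then 1 else 0 := by
  induction p with
  | _ a b =>
    rw [Sym2.mk_isDiag_iff] at hp
    simp only [pairMat, Sym2.lift_mk, twoSym, Matrix.add_apply, Matrix.vecMulVec_apply, e,
      Pi.single_apply, Option.some_inj, Sym2.eq_iff]
    grind

theorem diagLift_apply_none (c : V → ℝ) (j : Option V) : (diagLift c).1 none j = 0 := by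
  simp [diagLift, Matrix.diagonal_apply]

theorem diagLift_apply_self (c : V → ℝ) (j : V) : (diagLift c).1 (some j) (some j) = c j := by
  simp [diagLift]

theorem diagLift_apply_of_ne (c : V → ℝ) {i j : V} (hij : i ≠ j) :
    (diagLift c).1 (some i) (some j) = 0 := by
  simp [diagLift, hij]

theorem diagLift_apply_mem {R : Subring ℝ} {c : V → ℝ} (hc : ∀ j, c j ∈ R) (i j : Option V) :
    (diagLift c).1 i j ∈ R := by
  refine ite_mem.2 ⟨fun _ => ?_, fun _ => zero_mem R⟩
  rcases i with _ | v
  exacts [zero_mem R, hc v]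

section Pairs

variable {H : SimpleGraph V} [Fintype H.edgeSet]

/-- The matrix supported on the edges of `H` with the entries `x`. -/
def edgePart (x : H.edgeSet → ℝ) : SymHat V :=
  ∑ p, x p • pairMat p.1

theorem edgePart_apply_none (x : H.edgeSet → ℝ) (j : Option V) : (edgePart x).1 none j = 0 := by
  simp [edgePart, SymHat.coe_sum_smul_apply, pairMat_apply_none]

theorem edgePart_apply_some (x : H.edgeSet → ℝ) (i j : V) :
    (edgePart x).1 (some i) (some j) = ∑ p, if p.1 = s(i, j) then x p else 0 := by
  simp [edgePart, SymHat.coe_sum_smul_apply,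
    pairMat_apply_some (H.not_isDiag_of_mem_edgeSet (Subtype.prop _))]

theorem edgePart_of_adj (x : H.edgeSet → ℝ) {i j : V} (h : H.Adj i j) :
    (edgePart x).1 (some i) (some j) = x ⟨s(i, j), h⟩ := by
  simp [edgePart_apply_some, ← Subtype.ext_iff (a2 := (⟨s(i, j), h⟩ : H.edgeSet))]

theorem edgePart_of_not_adj (x : H.edgeSet → ℝ) {i j : V} (h : ¬H.Adj i j) :
    (edgePart x).1 (some i) (some j) = 0 := by
  rw [edgePart_apply_some]
  exact sum_eq_zero fun p _ => if_neg fun hp => h (by simpa [hp] using p.2)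

end Pairs

variable [Fintype V]

/-- The combination of the matrices of `baseSystem V` with coefficient `a` for `e_0 e_0ᵀ`,
`z j` for `2 Sym(e_j (e_j - e_0)ᵀ)`, and `u j` for `e_j e_jᵀ`. -/
def basePart (a : ℝ) (z u : V → ℝ) : SymHat V :=
  a • outer (e none) + ∑ j, z j • twoSym (e (some j)) (e (some j) - e none) +
    ∑ j, u j • outer (e (some j))

theorem basePart_apply (a : ℝ) (z u : V → ℝ) (i j : Option V) :
    (basePart a z u).1 i j = a * (outer (e none)).1 i j +
      ∑ k, z k * (twoSym (e (some k)) (e (some k) - e none)).1 i j +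
      ∑ k, u k * (outer (e (some k))).1 i j := by
  simp [basePart, ← SymHat.coe_sum_smul_apply]

theorem basePart_none_none (a : ℝ) (z u : V → ℝ) : (basePart a z u).1 none none = a := by
  simp [basePart_apply, outer, twoSym, e, Matrix.vecMulVec_apply]

theorem basePart_none_some (a : ℝ) (z u : V → ℝ) (j : V) :
    (basePart a z u).1 none (some j) = -z j := by
  simp [basePart_apply, outer, twoSym, e, Matrix.vecMulVec_apply, Pi.single_apply]

theorem basePart_some_some (a : ℝ) (z u : V → ℝ) (i j : V) :
    (basePart a z u).1 (some i) (some j) = if i = j then 2 * z j + u j else 0 := by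
  have htwo (k : V) : (twoSym (e (some k)) (e (some k) - e none)).1 (some i) (some j) =
      if k = j then if i = j then 2 else 0 else 0 := by
    simp only [twoSym, e, Matrix.add_apply, Matrix.vecMulVec_apply, Pi.sub_apply, Pi.single_apply]
    grind
  have houter (k : V) : (outer (e (some k))).1 (some i) (some j) =
      if k = j then if i = j then 1 else 0 else 0 := by
    simp only [outer, e, Matrix.vecMulVec_apply, Pi.single_apply]
    grind
  have hnone : (outer (e none)).1 (some i) (some j) = 0 := by
    simp [outer, e, Matrix.vecMulVec_apply]
  simp only [basePart_apply, htwo, houter, hnone, mul_ite, mul_zero, mul_one, sum_ite_eq', mem_univ,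
    if_true, zero_add]
  split_ifs <;> ring

variable {G : SimpleGraph V} [Fintype G.edgeSet] [Fintype Gᶜ.edgeSet]

theorem basePart_add_edgePart_eq_iff {a : ℝ} {z u : V → ℝ} {x : G.edgeSet → ℝ}
    {x' : Gᶜ.edgeSet → ℝ} {M : SymHat V} :
    basePart a z u + edgePart x + edgePart x' = M ↔
      M.1 none none = a ∧ (∀ j, M.1 none (some j) = -z j) ∧
      (∀ j, M.1 (some j) (some j) = 2 * z j + u j) ∧
      (∀ i j (h : G.Adj i j), M.1 (some i) (some j) = x ⟨s(i, j), h⟩) ∧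
      ∀ i j (h : Gᶜ.Adj i j), M.1 (some i) (some j) = x' ⟨s(i, j), h⟩ := by
  have hentry (i j : Option V) : (basePart a z u + edgePart x + edgePart x').1 i j =
      (basePart a z u).1 i j + (edgePart x).1 i j + (edgePart x').1 i j := rfl
  constructor
  · rintro rfl
    simp only [hentry, edgePart_apply_none, basePart_none_none, basePart_none_some,
      basePart_some_some, add_zero, true_and, implies_true]
    refine ⟨fun j => ?_, fun i j h => ?_, fun i j h => ?_⟩
    · simp [edgePart_of_not_adj]
    · simp [edgePart_of_adj x h, edgePart_of_not_adj x' fun h' => h'.2 h, h.ne]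
    · simp [edgePart_of_adj x' h, edgePart_of_not_adj x h.2, h.ne]
  · rintro ⟨h00, h0, hdiag, hadj, hcompl⟩
    refine SymHat.ext_upper ?_ (fun j => ?_) fun i j => ?_
    · simp [hentry, edgePart_apply_none, basePart_none_none, h00]
    · simp [hentry, edgePart_apply_none, basePart_none_some, h0]
    · rw [hentry, basePart_some_some]
      by_cases hij : i = j
      · subst hij
        simp [edgePart_of_not_adj, hdiag]
      by_cases h : G.Adj i j
      · simp [edgePart_of_adj x h, edgePart_of_not_adj x' fun h' => h'.2 h, hij, hadj i j h]
      · have h' : Gᶜ.Adj i j := ⟨hij, h⟩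
        simp [edgePart_of_adj x' h', edgePart_of_not_adj x h, hij, hcompl i j h']

end Entries

section ThetaSystems

open scoped Pointwise

variable {V ι : Type*}

/-- The entry of a symmetric matrix at an unordered pair of elements of `V`. -/
def pairEntry (M : SymHat V) : Sym2 V → ℝ :=
  Sym2.lift ⟨fun i j => M.1 (some i) (some j), fun _ _ => SymHat.apply_comm M _ _⟩

theorem pairEntry_mem {H : SimpleGraph V} {M : SymHat V} {X : Set ℝ}
    (hM : ∀ i j, H.Adj i j → M.1 (some i) (some j) ∈ X) (p : H.edgeSet) :
    pairEntry M p ∈ X := by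
  obtain ⟨⟨i, j⟩, hp⟩ := p
  exact hM i j hp

/-- The matrices that the multipliers in `R` of a system of constraints produce: they are what
remains of the conditions on a dual slack when semidefiniteness is dropped and the objective is
`0`, with all entries in `R`. -/
structure IsMultiplierMatrix (G : SimpleGraph V) (A B : Set ℝ) (R : Subring ℝ) (M : SymHat V) :
    Prop where
  mem : ∀ i j, M.1 i j ∈ R
  diag_le : ∀ j, M.1 (some j) (some j) ≤ -2 * M.1 none (some j)
  of_adj : ∀ i j, G.Adj i j → M.1 (some i) (some j) ∈ A
  of_compl_adj : ∀ i j, Gᶜ.Adj i j → M.1 (some i) (some j) ∈ B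

theorem isMultiplierMatrix_of_upper {G : SimpleGraph V} {A B : Set ℝ} {R : Subring ℝ}
    {M : SymHat V} (h00 : M.1 none none ∈ R) (h0 : ∀ j, M.1 none (some j) ∈ R)
    (hdiag : ∀ j, M.1 (some j) (some j) ∈ (R : Set ℝ) ∩ Set.Iic (-2 * M.1 none (some j)))
    (hadj : ∀ i j, G.Adj i j → M.1 (some i) (some j) ∈ (R : Set ℝ) ∩ A)
    (hcompl : ∀ i j, Gᶜ.Adj i j → M.1 (some i) (some j) ∈ (R : Set ℝ) ∩ B) :
    IsMultiplierMatrix G A B R M where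
  mem i j := by
    rcases i with _ | i <;> rcases j with _ | j
    · exact h00
    · exact h0 j
    · exact SymHat.apply_comm M _ _ ▸ h0 i
    · by_cases hij : i = j
      · exact hij ▸ (hdiag i).1
      by_cases h : G.Adj i j
      exacts [(hadj i j h).1, (hcompl i j ⟨hij, h⟩).1]
  diag_le j := (hdiag j).2
  of_adj i j h := (hadj i j h).2
  of_compl_adj i j h := (hcompl i j h).2

variable [DecidableEq V] {G : SimpleGraph V} {A B : Set ℝ}

/-- A semidefinite system whose dual solutions for the objective `Diag(0 ⊕ c)` correspond to the
dual slacks with edge entries in `A` and non-edge entries in `B`. The first condition makes the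
value `bᵀ y` the upper left entry of the slack. -/
structure IsThetaSystem (G : SimpleGraph V) (A B : Set ℝ) [Fintype ι] (Sys : SDPSystem V ι) :
    Prop where
  b_eq : ∀ i, Sys.b i = (Sys.A i).1 none none
  mem_cone_iff : ∀ R M, M ∈ Sys.cone R ↔ IsMultiplierMatrix G A B R M

theorem baseSystem_b_eq (i : ((Unit ⊕ Unit) ⊕ (V ⊕ V)) ⊕ V) :
    (baseSystem V).b i = ((baseSystem V).A i).1 none none := by
  rcases i with ((_ | _) | (_ | _)) | _ <;>
    simp [baseSystem, SDPSystem.append, SDPSystem.eq, SDPSystem.le, SDPSystem.ge, outer, twoSym, e,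
      Matrix.vecMulVec_apply]

theorem thetaSystem_b_eq (i) : (thetaSystem G).b i = ((thetaSystem G).A i).1 none none := by
  rcases i with i | (p | p)
  · exact baseSystem_b_eq i
  · exact (pairMat_apply_none p.1 none).symm
  · exact neg_inj.2 (pairMat_apply_none p.1 none).symm

variable [Fintype V]

theorem mem_cone_baseSystem_iff {R : Subring ℝ} {M : SymHat V} :
    M ∈ (baseSystem V).cone R ↔ ∃ a ∈ R, ∃ z u : V → ℝ, (∀ j, z j ∈ R) ∧
      (∀ j, u j ∈ (R : Set ℝ) ∩ Set.Iic 0) ∧ basePart a z u = M := by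
  simp only [baseSystem, SDPSystem.cone_append, SDPSystem.cone_eq, SDPSystem.cone_ge]
  constructor
  · rintro ⟨_, ⟨_, ⟨a, ha, rfl⟩, _, ⟨z, hz, rfl⟩, rfl⟩, _, ⟨u, hu, rfl⟩, rfl⟩
    exact ⟨a (), ha (), z, u, hz, hu, by simp [basePart]⟩
  · rintro ⟨a, ha, z, u, hz, hu, rfl⟩
    exact Set.add_mem_add (Set.add_mem_add ⟨fun _ => a, fun _ => ha, by simp⟩ ⟨z, hz, rfl⟩)
      ⟨u, hu, rfl⟩

theorem mem_cone_baseSystem_add_combinations_iff [Fintype G.edgeSet] [Fintype Gᶜ.edgeSet]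
    {R : Subring ℝ} {M : SymHat V} :
    M ∈ (baseSystem V).cone R + combinations (fun p : G.edgeSet => pairMat p.1) (R ∩ A) +
        combinations (fun p : Gᶜ.edgeSet => pairMat p.1) (R ∩ B) ↔
      IsMultiplierMatrix G A B R M := by
  constructor
  · rintro ⟨_, ⟨_, hbase, _, ⟨x, hx, rfl⟩, rfl⟩, _, ⟨x', hx', rfl⟩, hM⟩
    obtain ⟨a, ha, z, u, hz, hu, rfl⟩ := mem_cone_baseSystem_iff.1 hbase
    obtain ⟨h00, h0, hdiag, hadj, hcompl⟩ := basePart_add_edgePart_eq_iff.1 hM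
    refine isMultiplierMatrix_of_upper (h00 ▸ ha) (fun j => h0 j ▸ neg_mem (hz j))
      (fun j => ⟨?_, ?_⟩) (fun i j h => hadj i j h ▸ hx _) fun i j h => hcompl i j h ▸ hx' _
    · rw [hdiag, two_mul]
      exact add_mem (add_mem (hz j) (hz j)) (hu j).1
    · rw [hdiag, h0, Set.mem_Iic]
      linarith [Set.mem_Iic.1 (hu j).2]
  · intro hM
    refine ⟨_, ⟨_, mem_cone_baseSystem_iff.2 ⟨M.1 none none, hM.mem _ _,
      fun j => -M.1 none (some j), fun j => M.1 (some j) (some j) + 2 * M.1 none (some j),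
      fun j => neg_mem (hM.mem _ _), fun j => ⟨?_, ?_⟩, rfl⟩, _, ⟨fun p => pairEntry M p,
      pairEntry_mem fun i j h => ⟨hM.mem _ _, hM.of_adj i j h⟩, rfl⟩, rfl⟩, _,
      ⟨fun p => pairEntry M p, pairEntry_mem fun i j h => ⟨hM.mem _ _, hM.of_compl_adj i j h⟩,
      rfl⟩, ?_⟩
    · beta_reduce
      rw [two_mul]
      exact add_mem (hM.mem _ _) (add_mem (hM.mem _ _) (hM.mem _ _))
    · rw [Set.mem_Iic]
      linarith [hM.diag_le j]
    · exact basePart_add_edgePart_eq_iff.2 ⟨rfl, fun j => (neg_neg _).symm, fun j => by ring,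
        fun _ _ _ => rfl, fun _ _ _ => rfl⟩

variable (G) [DecidableRel G.Adj]

theorem isThetaSystem_thetaSystem : IsThetaSystem G Set.univ {0} (thetaSystem G) where
  b_eq := thetaSystem_b_eq
  mem_cone_iff R M := by
    rw [← mem_cone_baseSystem_add_combinations_iff, Set.inter_univ,
      Set.inter_eq_right.2 (Set.singleton_subset_iff.2 (zero_mem R)), combinations_singleton_zero,
      add_zero, thetaSystem, SDPSystem.cone_append, SDPSystem.cone_eq]

theorem isThetaSystem_thetaPrimeSystem :
    IsThetaSystem G Set.univ (Set.Iic 0) (thetaPrimeSystem G) where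
  b_eq := by
    rintro (i | p)
    · exact thetaSystem_b_eq i
    · exact neg_inj.2 (pairMat_apply_none p.1 none).symm
  mem_cone_iff R M := by
    rw [← mem_cone_baseSystem_add_combinations_iff, Set.inter_univ, thetaPrimeSystem, thetaSystem,
      SDPSystem.cone_append, SDPSystem.cone_append, SDPSystem.cone_eq, SDPSystem.cone_ge]

theorem isThetaSystem_thetaPlusSystem :
    IsThetaSystem G (Set.Ici 0) {0} (thetaPlusSystem G) where
  b_eq := by
    rintro (i | p)
    · exact baseSystem_b_eq i
    · exact (pairMat_apply_none p.1 none).symm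
  mem_cone_iff R M := by
    rw [← mem_cone_baseSystem_add_combinations_iff,
      Set.inter_eq_right.2 (Set.singleton_subset_iff.2 (zero_mem R)), combinations_singleton_zero,
      add_zero, thetaPlusSystem, SDPSystem.cone_append, SDPSystem.cone_le]

theorem isAdmissible_univ_singleton_zero : IsAdmissible Set.univ {0} where
  isClosed_left := isClosed_univ
  isClosed_right := isClosed_singleton
  nonneg_mem _ _ := Set.mem_univ _
  zero_mem := Set.mem_singleton 0
  nonpos _ hs := hs.le

theorem isAdmissible_univ_Iic : IsAdmissible Set.univ (Set.Iic 0) where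
  isClosed_left := isClosed_univ
  isClosed_right := isClosed_Iic
  nonneg_mem _ _ := Set.mem_univ _
  zero_mem := Set.self_mem_Iic
  nonpos _ hs := hs

theorem isAdmissible_Ici_singleton_zero : IsAdmissible (Set.Ici 0) {0} where
  isClosed_left := isClosed_Ici
  isClosed_right := isClosed_singleton
  nonneg_mem _ hs := hs
  zero_mem := Set.mem_singleton 0
  nonpos _ hs := hs.le

end ThetaSystems

section TotalDualIntegrality

variable {V ι : Type*} [DecidableEq V] [Fintype ι] {G : SimpleGraph V} {A B : Set ℝ}
  {Sys : SDPSystem V ι}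

theorem IsThetaSystem.sum_b_mul (hSys : IsThetaSystem G A B Sys) (c : V → ℝ) (y : ι → ℝ) :
    ∑ i, Sys.b i * y i = (Sys.slack (diagLift c) y).1 none none := by
  have hslack : (Sys.slack (diagLift c) y).1 none none =
      (∑ i, y i • Sys.A i).1 none none - (diagLift c).1 none none := rfl
  simp [hslack, diagLift_apply_none, SymHat.coe_sum_smul_apply, hSys.b_eq, mul_comm]

theorem IsThetaSystem.isDualSlack (hSys : IsThetaSystem G A B Sys) {c : V → ℝ} {y : ι → ℝ}
    (hy : Sys.DualFeasible (diagLift c) y) :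
    IsDualSlack G A B c (Sys.slack (diagLift c) y).1 := by
  have hM := (hSys.mem_cone_iff ⊤ _).1 ⟨y, fun i => ⟨trivial, hy.1 i⟩, rfl⟩
  have hentry (i j : Option V) : (Sys.slack (diagLift c) y).1 i j =
      (∑ i, y i • Sys.A i).1 i j - (diagLift c).1 i j := rfl
  refine ⟨hy.2, fun j => ?_, fun i j h => ?_, fun i j h => ?_⟩
  · rw [hentry, hentry, diagLift_apply_none, diagLift_apply_self]
    linarith [hM.diag_le j]
  · rw [hentry, diagLift_apply_of_ne c h.ne, sub_zero]
    exact hM.of_adj i j h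
  · rw [hentry, diagLift_apply_of_ne c h.ne, sub_zero]
    exact hM.of_compl_adj i j h

theorem IsDualSlack.isMultiplierMatrix {R : Subring ℝ} {c : V → ℝ} {S : SymHat V}
    (hS : IsDualSlack G A B c S.1) (hc : ∀ j, c j ∈ R) (hSR : ∀ i j, S.1 i j ∈ R) :
    IsMultiplierMatrix G A B R (S + diagLift c) := by
  have hentry (i j : Option V) : (S + diagLift c).1 i j = S.1 i j + (diagLift c).1 i j := rfl
  refine ⟨fun i j => add_mem (hSR i j) (diagLift_apply_mem hc i j), fun j => ?_,
    fun i j h => ?_, fun i j h => ?_⟩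
  · rw [hentry, hentry, diagLift_apply_none, diagLift_apply_self]
    linarith [hS.le_diag j]
  · rw [hentry, diagLift_apply_of_ne c h.ne, add_zero]
    exact hS.of_adj i j h
  · rw [hentry, diagLift_apply_of_ne c h.ne, add_zero]
    exact hS.of_compl_adj i j h

theorem IsThetaSystem.exists_slack_eq (hSys : IsThetaSystem G A B Sys) {R : Subring ℝ}
    {c : V → ℝ} {S : Matrix (Option V) (Option V) ℝ} (hS : IsDualSlack G A B c S)
    (hc : ∀ j, c j ∈ R) (hSR : ∀ i j, S i j ∈ R) :
    ∃ y, (∀ i, y i ∈ R) ∧ Sys.DualFeasible (diagLift c) y ∧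
      (Sys.slack (diagLift c) y).1 = S := by
  have hsymm : S.transpose = S := by simpa using hS.posSemidef.isHermitian.eq
  obtain ⟨y, hy, hyM⟩ := (hSys.mem_cone_iff R (⟨S, hsymm⟩ + diagLift c)).2
    (IsDualSlack.isMultiplierMatrix hS hc hSR)
  have hslack : (Sys.slack (diagLift c) y).1 = S := congrArg Subtype.val (sub_eq_of_eq_add hyM)
  exact ⟨y, fun i => (hy i).1, ⟨fun i => (hy i).2, hslack ▸ hS.posSemidef⟩, hslack⟩

theorem IsThetaSystem.dualOptimal_iff (hSys : IsThetaSystem G A B Sys) {c : V → ℝ} {y : ι → ℝ} :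
    Sys.DualOptimal (diagLift c) y ↔ Sys.DualFeasible (diagLift c) y ∧ ∀ S,
      IsDualSlack G A B c S → (Sys.slack (diagLift c) y).1 none none ≤ S none none := by
  simp only [SDPSystem.DualOptimal, hSys.sum_b_mul c]
  refine and_congr_right fun _ => ⟨fun h S hS => ?_, fun h y' hy' => h _ (hSys.isDualSlack hy')⟩
  obtain ⟨y', -, hy', rfl⟩ := hSys.exists_slack_eq (R := ⊤) hS (fun _ => trivial)
    fun _ _ => trivial
  exact h y' hy'

variable [Fintype V]

theorem cliqueCoverNum_le_of_isTDIThrough (hAB : IsAdmissible A B)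
    (hSys : IsThetaSystem G A B Sys) (hTDI : IsTDIThrough Sys diagLift) {w : V → ℕ}
    {S : Matrix (Option V) (Option V) ℝ} (hS : IsDualSlack G A B (fun v => w v) S) :
    (cliqueCoverNum G w : ℝ) ≤ S none none := by
  obtain ⟨S₀, hS₀, hmin⟩ := exists_isDualSlack_forall_le G hAB fun v => (w v : ℝ)
  obtain ⟨y₀, -, hy₀, rfl⟩ := hSys.exists_slack_eq (R := ⊤) hS₀ (fun _ => trivial)
    fun _ _ => trivial
  obtain ⟨y, hy, -, m, hm⟩ := hTDI (fun v => w v) ⟨y₀, by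
    simpa using hSys.dualOptimal_iff.2 ⟨hy₀, hmin⟩⟩
  simp only [Int.cast_natCast] at hy hm
  change _ = coverSlack m at hm
  obtain ⟨hfeas, hopt⟩ := hSys.dualOptimal_iff.1 hy
  have hcover : IsCliqueCover G w m :=
    IsDualSlack.isCliqueCover hAB (hm ▸ hSys.isDualSlack hfeas)
  calc (cliqueCoverNum G w : ℝ) ≤ ∑ K, (m K : ℝ) := by
        exact_mod_cast cliqueCoverNum_le ⟨m, hcover, le_rfl⟩
    _ = (Sys.slack (diagLift fun v => (w v : ℝ)) y).1 none none := by
        rw [← coverSlack_none_none, hm]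
    _ ≤ S none none := hopt S hS

theorem mul_cliqueCoverNum_le_of_isTDIThrough (hAB : IsAdmissible A B)
    (hSys : IsThetaSystem G A B Sys) (hTDI : IsTDIThrough Sys diagLift) (k : ℕ) (w : V → ℕ) :
    k * cliqueCoverNum G w ≤ cliqueCoverNum G (k • w) := by
  rcases k.eq_zero_or_pos with rfl | hk
  · simp
  have hk' : (0 : ℝ) < k := Nat.cast_pos.2 hk
  obtain ⟨m, hm, hcard⟩ := hasCliqueCover_cliqueCoverNum G (k • w)
  have hS : IsDualSlack G A B (fun v => (w v : ℝ)) ((k : ℝ)⁻¹ • coverSlack m) :=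
    hm.isDualSlack_smul hAB (inv_nonneg.2 hk'.le) fun j => by simp [hk'.ne']
  have hle := cliqueCoverNum_le_of_isTDIThrough hAB hSys hTDI hS
  rw [Matrix.smul_apply, coverSlack_none_none, smul_eq_mul, le_inv_mul_iff₀ hk'] at hle
  have hcard' : ∑ K, (m K : ℝ) ≤ cliqueCoverNum G (k • w) := by exact_mod_cast hcard
  exact_mod_cast hle.trans hcard'

theorem isTDIThrough_of_isPerfect (hAB : IsAdmissible A B) (hSys : IsThetaSystem G A B Sys)
    (hG : IsPerfect G) : IsTDIThrough Sys diagLift := by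
  intro c _
  obtain ⟨T, hT, hcover⟩ := hG.weightedPerfect.compl.exists_isClique fun v => (c v).toNat
  rw [compl_compl] at hcover
  obtain ⟨m, hm, hcard⟩ := hcover
  have hS : IsDualSlack G A B (fun v => (c v : ℝ)) (coverSlack m) := by
    rw [← one_smul ℝ (coverSlack m)]
    refine hm.isDualSlack_smul hAB zero_le_one fun j => ?_
    rw [one_mul]
    exact_mod_cast Int.self_le_toNat (c j)
  obtain ⟨y, hyint, hy, hyS⟩ := hSys.exists_slack_eq hS (fun j => intCast_mem _ (c j))
    (coverSlack_mem_intRange m)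
  refine ⟨y, hSys.dualOptimal_iff.2 ⟨hy, fun S' hS' => ?_⟩, fun i => ?_, m, hyS⟩
  · rw [hyS, coverSlack_none_none]
    calc ∑ K, (m K : ℝ) ≤ ((∑ v ∈ T, (c v).toNat : ℕ) : ℝ) := by exact_mod_cast hcard
      _ ≤ S' none none := hS'.sum_toNat_le_of_isClique_compl hAB hT
  · obtain ⟨n, hn⟩ := hyint i
    exact ⟨n, hn.symm⟩

theorem isTDIThrough_iff_isPerfect (hAB : IsAdmissible A B) (hSys : IsThetaSystem G A B Sys) :
    IsTDIThrough Sys diagLift ↔ IsPerfect G := by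
  refine ⟨fun hTDI => ?_, isTDIThrough_of_isPerfect hAB hSys⟩
  have hperfect : WeightedPerfect Gᶜ := weightedPerfect_compl_of_isSublinear
    (isSublinear_cliqueCoverNum (mul_cliqueCoverNum_le_of_isTDIThrough hAB hSys hTDI))
  simpa using hperfect.compl.isPerfect

end TotalDualIntegrality

end ThetaTDI

theorem theorem17 {V : Type*} [Fintype V] [DecidableEq V] (G : SimpleGraph V)
    [DecidableRel G.Adj] :
    (ThetaTDI.IsTDIThrough (ThetaTDI.thetaSystem G) ThetaTDI.diagLift ↔ ThetaTDI.IsPerfect G) ∧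
    (ThetaTDI.IsTDIThrough (ThetaTDI.thetaPrimeSystem G) ThetaTDI.diagLift ↔
      ThetaTDI.IsPerfect G) ∧
    (ThetaTDI.IsTDIThrough (ThetaTDI.thetaPlusSystem G) ThetaTDI.diagLift ↔
      ThetaTDI.IsPerfect G) :=
  ⟨ThetaTDI.isTDIThrough_iff_isPerfect ThetaTDI.isAdmissible_univ_singleton_zero
      (ThetaTDI.isThetaSystem_thetaSystem G),
    ThetaTDI.isTDIThrough_iff_isPerfect ThetaTDI.isAdmissible_univ_Iic
      (ThetaTDI.isThetaSystem_thetaPrimeSystem G),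
    ThetaTDI.isTDIThrough_iff_isPerfect ThetaTDI.isAdmissible_Ici_singleton_zero
      (ThetaTDI.isThetaSystem_thetaPlusSystem G)⟩
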